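/- Let $A=(a_{ij})_{i,j\in I}$ be an indecomposable Cartan matrix of finite type, i.e. $a_{ij}=\langle\alpha_j,\alpha_i^\vee\rangle$ for a base $\{\alpha_i\}_{i\in I}$ of a finite, reduced, irreducible, crystallographic root system, with Weyl group $W$ and simple reflections $s_i$, so that $s_i\alpha_j=\alpha_j-a_{ij}\alpha_i$. Let $(d_i)_{i\in I}$ be positive integers such that $d_ia_{ij}=d_ja_{ji}$ for all $i,j$, normalised so that $d_j=1$ whenever $a_{ji}\le -2$ for some $i$ (which is automatic if the $d_i$ have no common divisor). Let $q\in\mathbb C^\times$ not be a root of unity, and put $q_i=q^{d_i}$. Let $\mathcal P^+$ be the monoid, under coordinatewise multiplication, of $I$-tuples of polynomials in $\mathbb C[u]$ with constant term $1$, and let $\mathcal P\supset\mathcal P^+$ be the group it generates inside the $I$-tuples of non-zero rational functions in $u$. For $i\in I$ and $a\in\mathbb C^\times$ let $\pi_{i,a}\in\mathcal P^+$ have $i$-th coordinate $1-au$ and all other coordinates $1$. For $i\in I$ let $\tilde T_i:\mathcal P\to\mathcal P$ be the group homomorphism given, for $\varpi=(\varpi_j)_{j\in I}$, by $$(\tilde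 T_i\varpi)_i=\frac1{\varpi_i(q_i^2u)},$$ and for $j\neq i$ by $$(\tilde T_i\varpi)_j=\begin{cases}\varpi_j(u), & a_{ji}=0,\\ \varpi_j(u)\varpi_i(q_iu), & a_{ji}=-1,\\ \varpi_j(u)\varpi_i(q^3u)\varpi_i(qu), & a_{ji}=-2,\\ \varpi_j(u)\varpi_i(q^5u)\varpi_i(q^3u)\varpi_i(qu), & a_{ji}=-3.\end{cases}$$ For $w\in W$ with reduced expression $w=s_{i_1}\cdots s_{i_k}$ put $\tilde T_w=\tilde T_{i_1}\cdots\tilde T_{i_k}$ (this does not depend on the reduced expression; the assertion below is made for every reduced expression of $w$). Let $\alpha_{i,a}=(\tilde T_i\pi_{i,a})^{-1}\pi_{i,a}$, let $\mathcal Q^+$ be the submonoid of $\mathcal P$ generated by all $\alpha_{i,a}$ with $i\in I$, $a\in\mathbb C^\times$, let $\mathcal Q^-=(\mathcal Q^+)^{-1}$, and write $\varpi\preccurlyeq\varpi'$ if $\varpi\in\varpi'\mathcal Q^-$. **Corollary.** If $\pi\in\mathcal P^+$ and $w\in W$, then $\tilde T_w\pi\preccurlyeq\pi$, i.e. $\tilde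 T_w\pi\in\pi\,\mathcal Q^-$. -/

import Mathlib

/-! # The ℓ-weight lattice, the ℓ-root lattice and the braid group action -/

noncomputable section

namespace QAff

open Polynomial

section RootDatum

variable {ι k M N : Type*} [Field k] [AddCommGroup M] [Module k M]
  [AddCommGroup N] [Module k N] {R : RootPairing ι k M N}

/-- The Cartan matrix `a i j = ⟨α_j, α_i^∨⟩`, in the convention `s_i α_j = α_j - a_ij α_i`
(the transpose of Mathlib's convention). -/
def cartan [R.IsCrystallographic] (b : R.Base) : Matrix b.support b.support ℤ :=
  b.cartanMatrix.transpose

/-- The convention is as announced: `s_i α_j = α_j - a_ij α_i`. -/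
theorem reflection_simple_root [R.IsCrystallographic] (b : R.Base) (i j : b.support) :
    R.reflection i (R.root j) = R.root j - (cartan b i j) • R.root i := by
  have h : ((cartan b i j : ℤ) : k) = R.pairing j i := by
    have := b.algebraMap_cartanMatrixIn_apply ℤ j i
    simpa [cartan] using this
  rw [R.reflection_apply_root, ← h, Int.cast_smul_eq_zsmul]

/-- The product `s_{i₁} ⋯ s_{i_r}` of simple reflections in the Weyl group. -/
def simpleWord (b : R.Base) (l : List b.support) : R.weylGroup :=
  (l.map fun i => RootPairing.weylGroup.ofIdx R (i : ι)).prod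

/-- `s_{i₁} ⋯ s_{i_r}` is a reduced expression of `w`: its product is `w`, and no product of fewer
simple reflections is `w`. -/
def IsReducedExpression (b : R.Base) (l : List b.support) (w : R.weylGroup) : Prop :=
  simpleWord b l = w ∧ ∀ l' : List b.support, simpleWord b l' = w → l.length ≤ l'.length

end RootDatum

section Lattices

variable {I : Type*}

/-- The ring homomorphism `ϖ(u) ↦ ϖ(c u)` of `ℂ(u)`, for `c ≠ 0`. -/
def dilate (c : ℂˣ) : RatFunc ℂ →+* RatFunc ℂ :=
  RatFunc.mapRingHom (compRingHom (C (c : ℂ) * X)) (by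
    intro p hp
    rw [Submonoid.mem_comap, mem_nonZeroDivisors_iff_ne_zero]
    rw [mem_nonZeroDivisors_iff_ne_zero] at hp
    simpa [coe_compRingHom_apply, comp_C_mul_X_eq_zero_iff] using hp)

/-- The units of `ℂ(u)` under `ϖ(u) ↦ ϖ(c u)`. -/
def dilateUnits (c : ℂˣ) : (RatFunc ℂ)ˣ →* (RatFunc ℂ)ˣ :=
  Units.map (dilate c : RatFunc ℂ →* RatFunc ℂ)

variable (I) in
/-- `𝒫⁺`, the monoid of `I`-tuples of polynomials with constant term one, inside the group of
`I`-tuples of non-zero rational functions. -/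
def polyTuples : Submonoid (I → (RatFunc ℂ)ˣ) where
  carrier := {ϖ | ∀ i, ∃ p : ℂ[X], p.coeff 0 = 1 ∧
    ((ϖ i : (RatFunc ℂ)ˣ) : RatFunc ℂ) = algebraMap ℂ[X] (RatFunc ℂ) p}
  one_mem' := fun _ => ⟨1, by simp⟩
  mul_mem' := by
    intro x y hx hy i
    obtain ⟨p, hp, hp'⟩ := hx i
    obtain ⟨r, hr, hr'⟩ := hy i
    exact ⟨p * r, by simp [mul_coeff_zero, hp, hr], by simp [hp', hr']⟩

variable (I) in
/-- The ℓ-weight lattice `𝒫`: the group generated by `𝒫⁺`. -/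
def ellWeights : Subgroup (I → (RatFunc ℂ)ˣ) :=
  Subgroup.closure (polyTuples I : Set (I → (RatFunc ℂ)ˣ))

variable (I) in
/-- `𝒫⁺` as a submonoid of `𝒫`. -/
def dominant : Submonoid (ellWeights I) :=
  (polyTuples I).comap (ellWeights I).subtype

theorem one_sub_C_mul_X_ne_zero (a : ℂ) : algebraMap ℂ[X] (RatFunc ℂ) (1 - C a * X) ≠ 0 := by
  apply RatFunc.algebraMap_ne_zero
  intro h
  have := congrArg (fun p => coeff p 0) h
  simp at this

variable [DecidableEq I]

/-- The tuple with `i`-th coordinate `1 - a u` and all other coordinates one. -/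
def fundTuple (i : I) (a : ℂˣ) : I → (RatFunc ℂ)ˣ :=
  Pi.mulSingle i (Units.mk0 _ (one_sub_C_mul_X_ne_zero (a : ℂ)))

theorem fundTuple_mem (i : I) (a : ℂˣ) : fundTuple i a ∈ polyTuples I := by
  intro j
  rcases eq_or_ne j i with rfl | h
  · exact ⟨1 - C (a : ℂ) * X, by simp, by simp [fundTuple]⟩
  · exact ⟨1, by simp, by simp [fundTuple, h]⟩

/-- The fundamental ℓ-weight `π_{i,a}`. -/
def fund (i : I) (a : ℂˣ) : ellWeights I :=
  ⟨fundTuple i a, Subgroup.subset_closure (fundTuple_mem i a)⟩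

/-- The formula for `T̃_i` on `I`-tuples `ϖ` of rational functions; here `q_i = q ^ d i`. -/
def braidFun (A : Matrix I I ℤ) (d : I → ℕ) (q : ℂˣ) (i : I) (ϖ : I → (RatFunc ℂ)ˣ) :
    I → (RatFunc ℂ)ˣ := fun j =>
  if j = i then (dilateUnits ((q ^ d i) ^ 2) (ϖ i))⁻¹
  else if A j i = -1 then ϖ j * dilateUnits (q ^ d i) (ϖ i)
  else if A j i = -2 then ϖ j * dilateUnits (q ^ 3) (ϖ i) * dilateUnits q (ϖ i)
  else if A j i = -3 then
    ϖ j * dilateUnits (q ^ 5) (ϖ i) * dilateUnits (q ^ 3) (ϖ i) * dilateUnits q (ϖ i)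
  else ϖ j

/-- `braidFun` is a group homomorphism. -/
def braidHom (A : Matrix I I ℤ) (d : I → ℕ) (q : ℂˣ) (i : I) :
    (I → (RatFunc ℂ)ˣ) →* (I → (RatFunc ℂ)ˣ) :=
  MonoidHom.mk' (braidFun A d q i) (by
    intro x y
    funext j
    simp only [braidFun, Pi.mul_apply]
    split_ifs
    · simp only [map_mul, mul_inv]
    · rw [map_mul, mul_mul_mul_comm]
    · rw [map_mul, map_mul]; ac_rfl
    · rw [map_mul, map_mul, map_mul]; ac_rfl
    · rfl)

theorem dilate_algebraMap (c : ℂˣ) (p : ℂ[X]) :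
    dilate c (algebraMap ℂ[X] (RatFunc ℂ) p) =
      algebraMap ℂ[X] (RatFunc ℂ) (p.comp (C (c : ℂ) * X)) := by
  have h := RatFunc.map_apply_div (φ := compRingHom (C (c : ℂ) * X)) (by
    intro p hp
    rw [Submonoid.mem_comap, mem_nonZeroDivisors_iff_ne_zero]
    rw [mem_nonZeroDivisors_iff_ne_zero] at hp
    simpa [coe_compRingHom_apply, comp_C_mul_X_eq_zero_iff] using hp) p 1
  simpa [dilate, RatFunc.coe_mapRingHom_eq_coe_map] using h

/-- `T̃_i` preserves the ℓ-weight lattice. -/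
theorem braidHom_mem (A : Matrix I I ℤ) (d : I → ℕ) (q : ℂˣ) (i : I) (x : I → (RatFunc ℂ)ˣ)
    (hx : x ∈ ellWeights I) : braidHom A d q i x ∈ ellWeights I := by
  induction hx using Subgroup.closure_induction with
  | one => rw [map_one]; exact one_mem _
  | mul x y _ _ hx hy => rw [map_mul]; exact mul_mem hx hy
  | inv x _ hx => rw [map_inv]; exact inv_mem hx
  | mem x hx =>
    have hdil : ∀ c : ℂˣ, ∃ p : ℂ[X], p.coeff 0 = 1 ∧
        ((dilateUnits c (x i) : (RatFunc ℂ)ˣ) : RatFunc ℂ) = algebraMap ℂ[X] (RatFunc ℂ) p := by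
      intro c
      obtain ⟨p, hp, hp'⟩ := hx i
      refine ⟨p.comp (C (c : ℂ) * X), ?_, ?_⟩
      · rw [coeff_zero_eq_eval_zero] at hp ⊢
        simpa [eval_comp] using hp
      · rw [← dilate_algebraMap, ← hp']
        rfl
    have hmul : ∀ y z : (RatFunc ℂ)ˣ,
        (∃ p : ℂ[X], p.coeff 0 = 1 ∧ (y : RatFunc ℂ) = algebraMap ℂ[X] (RatFunc ℂ) p) →
        (∃ p : ℂ[X], p.coeff 0 = 1 ∧ (z : RatFunc ℂ) = algebraMap ℂ[X] (RatFunc ℂ) p) →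
        ∃ p : ℂ[X], p.coeff 0 = 1 ∧
          ((y * z : (RatFunc ℂ)ˣ) : RatFunc ℂ) = algebraMap ℂ[X] (RatFunc ℂ) p := by
      rintro y z ⟨p, hp, hp'⟩ ⟨r, hr, hr'⟩
      exact ⟨p * r, by simp [mul_coeff_zero, hp, hr], by simp [hp', hr']⟩
    set D : I → (RatFunc ℂ)ˣ := Pi.mulSingle i (dilateUnits ((q ^ d i) ^ 2) (x i)) with hD
    have hDm : D ∈ polyTuples I := by
      intro j
      rcases eq_or_ne j i with rfl | h
      · simpa [hD] using hdil _
      · exact ⟨1, by simp, by simp [hD, h]⟩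
    have hE : Function.update (braidHom A d q i x) i 1 ∈ polyTuples I := by
      intro j
      rcases eq_or_ne j i with rfl | h
      · exact ⟨1, by simp, by simp⟩
      · rw [Function.update_of_ne h]
        change ∃ p : ℂ[X], p.coeff 0 = 1 ∧
          ((braidFun A d q i x j : (RatFunc ℂ)ˣ) : RatFunc ℂ) = algebraMap ℂ[X] (RatFunc ℂ) p
        rw [braidFun, if_neg h]
        split_ifs
        · exact hmul _ _ (hx j) (hdil _)
        · exact hmul _ _ (hmul _ _ (hx j) (hdil _)) (hdil _)
        · exact hmul _ _ (hmul _ _ (hmul _ _ (hx j) (hdil _)) (hdil _)) (hdil _)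
        · exact hx j
    have hEq : braidHom A d q i x = D⁻¹ * Function.update (braidHom A d q i x) i 1 := by
      funext j
      rcases eq_or_ne j i with rfl | h
      · simp [hD, braidHom, braidFun]
      · simp [hD, h]
    rw [hEq]
    exact mul_mem (inv_mem (Subgroup.subset_closure hDm)) (Subgroup.subset_closure hE)

/-- The operator `T̃_i` on the ℓ-weight lattice. -/
def braid (A : Matrix I I ℤ) (d : I → ℕ) (q : ℂˣ) (i : I) : Monoid.End (ellWeights I) :=
  ((braidHom A d q i).comp (ellWeights I).subtype).codRestrict (ellWeights I)
    fun x => braidHom_mem A d q i x x.2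

/-- The composite `T̃_{i₁} ⋯ T̃_{i_r}`. -/
def braidWord (A : Matrix I I ℤ) (d : I → ℕ) (q : ℂˣ) (l : List I) : Monoid.End (ellWeights I) :=
  (l.map (braid A d q)).prod

/-- `α_{i,a} = (T̃_i π_{i,a})⁻¹ π_{i,a}`. -/
def ellRoot (A : Matrix I I ℤ) (d : I → ℕ) (q : ℂˣ) (i : I) (a : ℂˣ) : ellWeights I :=
  (braid A d q i (fund i a))⁻¹ * fund i a

/-- `𝒬⁺`, the monoid generated by the `α_{i,a}`. -/
def ellRootsPos (A : Matrix I I ℤ) (d : I → ℕ) (q : ℂˣ) : Submonoid (ellWeights I) :=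
  Submonoid.closure {x | ∃ (i : I) (a : ℂˣ), x = ellRoot A d q i a}

/-- `𝒬⁻ = (𝒬⁺)⁻¹`. -/
def ellRootsNeg (A : Matrix I I ℤ) (d : I → ℕ) (q : ℂˣ) : Submonoid (ellWeights I) :=
  (ellRootsPos A d q).map (invMonoidHom : ellWeights I →* ellWeights I)

/-- `ϖ ≼ ϖ'` iff `ϖ ∈ ϖ' 𝒬⁻`. -/
def ellLE (A : Matrix I I ℤ) (d : I → ℕ) (q : ℂˣ) (ϖ ϖ' : ellWeights I) : Prop :=
  ∃ β ∈ ellRootsNeg A d q, ϖ = ϖ' * β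

end Lattices

section RootDatum

variable {ι k M N : Type*} [Field k] [AddCommGroup M] [Module k M]
  [AddCommGroup N] [Module k N] {R : RootPairing ι k M N}

theorem reflection_reflectionPerm' (i j : ι) :
    RootPairing.Equiv.reflection R (R.reflectionPerm j i) =
      RootPairing.Equiv.reflection R j * RootPairing.Equiv.reflection R i *
        RootPairing.Equiv.reflection R j := by
  apply RootPairing.Equiv.weightHom_injective R
  rw [map_mul, map_mul]
  simp only [RootPairing.Equiv.weightHom_apply, RootPairing.Equiv.reflection_weightEquiv]
  exact R.reflection_reflectionPerm

theorem simpleWord_append (b : R.Base) (l l' : List b.support) :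
    simpleWord b (l ++ l') = simpleWord b l * simpleWord b l' := by
  simp [simpleWord]

/-- Every element of the Weyl group has a reduced expression. -/
theorem exists_isReducedExpression [CharZero k] [Finite ι] [R.IsRootSystem] [R.IsCrystallographic]
    [R.IsReduced] (b : R.Base) (w : R.weylGroup) :
    ∃ l : List b.support, IsReducedExpression b l w := by
  have key : ∃ l : List b.support, simpleWord b l = w := by
    have hrefl : ∀ i : ι, ∃ l : List b.support,
        (simpleWord b l : RootPairing.Aut R) = RootPairing.Equiv.reflection R i := by
      intro i
      refine b.induction_reflect i (p := fun i => ∃ l : List b.support,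
        (simpleWord b l : RootPairing.Aut R) = RootPairing.Equiv.reflection R i) ?_ ?_ ?_
      · rintro i ⟨l, hl⟩
        exact ⟨l ++ l ++ l, by
          rw [simpleWord_append, simpleWord_append, reflection_reflectionPerm']
          simp [hl]⟩
      · intro i hi
        exact ⟨[⟨i, hi⟩], by simp [simpleWord, RootPairing.weylGroup.ofIdx]⟩
      · rintro i j ⟨l, hl⟩ hj
        exact ⟨[⟨j, hj⟩] ++ l ++ [⟨j, hj⟩], by
          rw [simpleWord_append, simpleWord_append, reflection_reflectionPerm']
          simp [simpleWord, RootPairing.weylGroup.ofIdx] at hl ⊢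
          simp [hl]⟩
    obtain ⟨w, hw⟩ := w
    suffices ∃ l : List b.support, (simpleWord b l : RootPairing.Aut R) = w by
      obtain ⟨l, hl⟩ := this
      exact ⟨l, Subtype.ext hl⟩
    induction hw using RootPairing.weylGroup.induction with
    | mem i => exact hrefl i
    | one => exact ⟨[], by simp [simpleWord]⟩
    | mul x y _ _ hx hy =>
      obtain ⟨l, hl⟩ := hx
      obtain ⟨l', hl'⟩ := hy
      exact ⟨l ++ l', by rw [simpleWord_append]; simp [hl, hl']⟩
  classical
  have hn : ∃ n, ∃ l : List b.support, l.length = n ∧ simpleWord b l = w :=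
    let ⟨l, hl⟩ := key; ⟨_, l, rfl, hl⟩
  obtain ⟨l, hl, hw⟩ := Nat.find_spec hn
  exact ⟨l, hw, fun l' h' => hl ▸ Nat.find_min' hn ⟨l', rfl, h'⟩⟩

end RootDatum

end QAff

end

/-!
Write the group of non-zero rational functions additively and let `ℤ[q]` act on it, the
indeterminate acting by `ϖ(u) ↦ ϖ(q u)`. Then `(T̃_i ϖ)_j = ϖ_j - c_ij ϖ_i`, where the matrix `c`
over `ℤ[q]` is a deformation of the Cartan matrix: the `T̃_i` are deformed simple reflections.

The classical argument that `l(s_i w) > l(w)` implies `w⁻¹ α_i > 0` survives the deformation. In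
rank two, the alternating products of `T̃_i` and `T̃_j` can be computed: the coefficients that occur
are polynomials in `q` with nonnegative coefficients, and the braid relations hold. In general one
splits a reduced word into an alternating prefix in two letters and a rest which is positive for
both, and inducts on the length. Hence, if `s_i w` is longer than `w` and `π ∈ 𝒫⁺`, then
`(T̃_w π)_i` is an `ℕ[q]`-combination of the coordinates of `π`, that is, a polynomial with constant
term one.

Such a polynomial factors over `ℂ` into terms `1 - a u`, while `T̃_i` fixes the tuples whose `i`-th
coordinate is one, so `T̃_i T̃_w π` is `T̃_w π` divided by the corresponding `α_{i,a}`. Apply this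
to each letter of a reduced word.
-/

noncomputable section

namespace QAff

open Polynomial

section CoxeterCombinatorics

variable {I G V : Type*}

/-- The word `i, j, i, …` of length `n`. -/
def altWord : I → I → ℕ → List I
  | _, _, 0 => []
  | i, j, n + 1 => i :: altWord j i n

theorem length_altWord (i j : I) (n : ℕ) : (altWord i j n).length = n := by
  induction n generalizing i j with
  | zero => rfl
  | succ n ih => rw [altWord, List.length_cons, ih]

theorem altWord_prefix_of_le {m n : ℕ} (h : m ≤ n) (i j : I) : altWord i j m <+: altWord i j n := by
  induction m generalizing i j n with
  | zero => exact List.nil_prefix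
  | succ m ih =>
    obtain ⟨n, rfl⟩ := Nat.exists_eq_add_of_le' (Nat.zero_lt_of_lt h)
    exact (List.prefix_cons_inj i).mpr (ih (Nat.le_of_succ_le_succ h) j i)

theorem head?_altWord_append {n : ℕ} (h : 0 < n) (i j : I) (l : List I) :
    (altWord i j n ++ l).head? = some i := by
  obtain ⟨n, rfl⟩ := Nat.exists_eq_add_of_le' h
  rfl

/-- Involutions `s i` in a group `G` together with predicates `Pos i`, where `Pos i w` is to be read
as `w⁻¹ α_i > 0` for the simple root `α_i`. The axioms are those of Bourbaki's characterisation of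
Coxeter systems by half-spaces (*Lie*, IV.1.7), together with braid relations of lengths `m i j` for
which the shorter alternating products lie in the expected half-space. -/
structure PositiveSystem (I G : Type*) [Group G] where
  s : I → G
  Pos : I → G → Prop
  m : I → I → ℕ
  s_mul_self : ∀ i, s i * s i = 1
  pos_one : ∀ i, Pos i 1
  pos_s_mul_iff : ∀ i w, Pos i (s i * w) ↔ ¬ Pos i w
  exchange : ∀ i j w, Pos i w → ¬ Pos i (w * s j) → w * s j = s i * w
  m_symm : ∀ i j, m i j = m j i
  m_pos : ∀ i j, 0 < m i j
  braid : ∀ i j, i ≠ j →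
    ((altWord i j (m i j)).map s).prod = ((altWord j i (m i j)).map s).prod
  pos_altWord : ∀ i j n, i ≠ j → n < m i j → Pos i ((altWord j i n).map s).prod

namespace PositiveSystem

variable [Group G] (P : PositiveSystem I G)

/-- The product of a word in the generators. -/
def prod (l : List I) : G := (l.map P.s).prod

/-- A word is reduced if no shorter word has the same product. -/
def IsReduced (l : List I) : Prop := ∀ l', P.prod l' = P.prod l → l.length ≤ l'.length

theorem prod_nil : P.prod [] = 1 := rfl

theorem prod_cons (i : I) (l : List I) : P.prod (i :: l) = P.s i * P.prod l := by
  simp only [prod, List.map_cons, List.prod_cons]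

theorem prod_append (l l' : List I) : P.prod (l ++ l') = P.prod l * P.prod l' := by
  simp only [prod, List.map_append, List.prod_append]

theorem s_mul_cancel_left (i : I) (w : G) : P.s i * (P.s i * w) = w := by
  rw [← mul_assoc, P.s_mul_self, one_mul]

variable {P}

theorem exists_prod_eq_s_mul {i : I} {v : G} {l : List I} (hv : P.Pos i v)
    (hl : ¬ P.Pos i (v * P.prod l)) :
    ∃ l', l'.length + 1 = l.length ∧ v * P.prod l' = P.s i * (v * P.prod l) := by
  induction l generalizing v with
  | nil => exact absurd (by rwa [prod_nil, mul_one]) hl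
  | cons j l ih =>
    rw [prod_cons, ← mul_assoc v] at hl ⊢
    by_cases hvj : P.Pos i (v * P.s j)
    · obtain ⟨l', hlen, hprod⟩ := ih hvj hl
      exact ⟨j :: l', by simp only [List.length_cons, hlen], by rw [prod_cons, ← mul_assoc, hprod]⟩
    · exact ⟨l, rfl, by
        rw [P.exchange i j v hv hvj, mul_assoc, P.s_mul_cancel_left]⟩

theorem exists_cons_of_not_pos {i : I} {l : List I} (hl : ¬ P.Pos i (P.prod l)) :
    ∃ l', l'.length + 1 = l.length ∧ P.prod (i :: l') = P.prod l := by
  obtain ⟨l', hlen, hprod⟩ := exists_prod_eq_s_mul (P.pos_one i) (by rwa [one_mul])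
  exact ⟨l', hlen, by rw [prod_cons, ← one_mul (P.prod l'), hprod, one_mul, P.s_mul_cancel_left]⟩

theorem not_pos_cons_iff {i : I} {l : List I} :
    ¬ P.Pos i (P.prod (i :: l)) ↔ P.Pos i (P.prod l) := by
  rw [prod_cons, P.pos_s_mul_iff, not_not]

theorem IsReduced.congr {l l' : List I} (h : P.IsReduced l) (hprod : P.prod l' = P.prod l)
    (hlen : l'.length = l.length) : P.IsReduced l' := fun k hk =>
  hlen ▸ h k (hk.trans hprod)

theorem IsReduced.of_append {l l' : List I} (h : P.IsReduced (l ++ l')) : P.IsReduced l' := by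
  intro k hk
  have := h (l ++ k) (by rw [prod_append, prod_append, hk])
  simpa only [List.length_append, add_le_add_iff_left] using this

theorem IsReduced.of_cons {i : I} {l : List I} (h : P.IsReduced (i :: l)) : P.IsReduced l :=
  of_append (l := [i]) h

theorem IsReduced.pos_of_cons {i : I} {l : List I} (h : P.IsReduced (i :: l)) :
    P.Pos i (P.prod l) := by
  by_contra hneg
  obtain ⟨l', hlen, hprod⟩ := exists_cons_of_not_pos hneg
  have := h l' (by rw [prod_cons, ← hprod, prod_cons, P.s_mul_cancel_left])
  rw [List.length_cons] at this
  omega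

/-- The alternating prefix is grown from the front: it lies in the half-space of the next letter, so
the letter can be exchanged against one of the tail. -/
theorem exists_altWord_append {i j : I} (hij : i ≠ j) {l : List I} (hi : ¬ P.Pos i (P.prod l))
    (hj : ¬ P.Pos j (P.prod l)) {n : ℕ} (hn : n ≤ P.m i j) :
    ∃ l₀, l₀.length + n = l.length ∧ P.prod (altWord i j n ++ l₀) = P.prod l := by
  induction n generalizing i j with
  | zero => exact ⟨l, rfl, rfl⟩
  | succ n ih =>
    obtain ⟨l₀, hlen, hprod⟩ := ih hij.symm hj hi (P.m_symm i j ▸ Nat.le_of_succ_le hn)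
    rw [prod_append] at hprod
    obtain ⟨l₁, hlen₁, hprod₁⟩ :=
      exists_prod_eq_s_mul (P.pos_altWord i j n hij hn) (l := l₀) (by rwa [← hprod] at hi)
    refine ⟨l₁, by omega, ?_⟩
    change P.prod (i :: (altWord j i n ++ l₁)) = _
    rw [prod_cons, prod_append, ← hprod, ← P.s_mul_cancel_left i (_ * P.prod l₀)]
    exact congrArg (P.s i * ·) hprod₁

theorem prod_altWord_m {i j : I} (hij : i ≠ j) :
    P.prod (altWord i j (P.m i j)) = P.prod (altWord j i (P.m i j)) :=
  P.braid i j hij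

theorem IsReduced.matsumoto {T : I → V → V}
    (hT : ∀ i j v, i ≠ j →
      (altWord i j (P.m i j)).foldr T v = (altWord j i (P.m i j)).foldr T v)
    {l l' : List I} (hl : P.IsReduced l) (hl' : P.IsReduced l') (h : P.prod l = P.prod l') (v : V) :
    l.foldr T v = l'.foldr T v := by
  induction hr : l.length generalizing l l' with
  | zero =>
    have hlen := hl' l h
    rw [hr, nonpos_iff_eq_zero] at hlen
    rw [List.length_eq_zero_iff.mp hr, List.length_eq_zero_iff.mp hlen]
  | succ r ih =>
    have of_head : ∀ {k : I} {u u' : List I}, P.IsReduced u → P.IsReduced u' →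
        P.prod u = P.prod u' → u.length = r + 1 → u.head? = some k → u'.head? = some k →
        u.foldr T v = u'.foldr T v := by
      intro k u u' hu hu' huu' hlen hk hk'
      obtain ⟨u, rfl⟩ := List.head?_eq_some_iff.mp hk
      obtain ⟨u', rfl⟩ := List.head?_eq_some_iff.mp hk'
      rw [prod_cons, prod_cons, mul_right_inj] at huu'
      exact congrArg (T k) (ih hu.of_cons hu'.of_cons huu' (Nat.succ.inj hlen))
    have hlen : l'.length = r + 1 := hr ▸ le_antisymm (hl' _ h) (hl _ h.symm)
    obtain ⟨i, l, rfl⟩ := List.exists_cons_of_length_eq_add_one hr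
    obtain ⟨j, l', rfl⟩ := List.exists_cons_of_length_eq_add_one hlen
    rcases eq_or_ne i j with rfl | hij
    · exact of_head hl hl' h hr rfl rfl
    · have hi := not_pos_cons_iff.mpr hl.pos_of_cons
      have hj := not_pos_cons_iff.mpr hl'.pos_of_cons
      obtain ⟨l₀, hlen₀, hprod⟩ := exists_altWord_append hij hi (h ▸ hj) le_rfl
      have hprod' : P.prod (altWord j i (P.m i j) ++ l₀) = P.prod (j :: l') := by
        rw [← h, ← hprod, prod_append, prod_append, prod_altWord_m hij]
      have hlen_alt (a b : I) : (altWord a b (P.m i j) ++ l₀).length = r + 1 := by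
        rw [List.length_append, length_altWord, add_comm, hlen₀, hr]
      calc (i :: l).foldr T v
          = (altWord i j (P.m i j) ++ l₀).foldr T v :=
            of_head hl (hl.congr hprod ((hlen_alt i j).trans hr.symm)) hprod.symm hr rfl
              (head?_altWord_append (P.m_pos i j) i j l₀)
        _ = (altWord j i (P.m i j) ++ l₀).foldr T v := by
            rw [List.foldr_append, List.foldr_append, hT i j _ hij]
        _ = (j :: l').foldr T v :=
            of_head (hl'.congr hprod' ((hlen_alt j i).trans hlen.symm)) hl' hprod' (hlen_alt j i)
              (head?_altWord_append (P.m_pos i j) j i l₀) rfl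

theorem exists_altWord_append_of_pos {i j : I} {l : List I} (hi : P.Pos i (P.prod l)) :
    ∃ n l₀, l₀.length + n = l.length ∧ P.prod (altWord j i n ++ l₀) = P.prod l ∧
      P.Pos i (P.prod l₀) ∧ P.Pos j (P.prod l₀) := by
  induction hr : l.length generalizing i j l with
  | zero =>
    rw [List.length_eq_zero_iff.mp hr]
    exact ⟨0, [], rfl, rfl, P.pos_one i, P.pos_one j⟩
  | succ r ih =>
    by_cases hj : P.Pos j (P.prod l)
    · exact ⟨0, l, hr, rfl, hi, hj⟩
    · obtain ⟨l₁, hlen₁, hprod₁⟩ := exists_cons_of_not_pos hj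
      rw [← hprod₁, not_pos_cons_iff] at hj
      obtain ⟨n, l₀, hlen, hprod, hpos⟩ := ih (j := i) hj (by omega)
      refine ⟨n + 1, l₀, by omega, ?_, hpos.symm⟩
      change P.prod (j :: (altWord i j n ++ l₀)) = _
      rw [prod_cons, hprod, ← prod_cons, hprod₁]

theorem IsReduced.lt_m_of_pos {i j : I} (hij : i ≠ j) {n : ℕ} {l : List I}
    (h : P.IsReduced (altWord j i n ++ l)) (hi : P.Pos i (P.prod (altWord j i n ++ l))) :
    n < P.m i j := by
  by_contra! hn
  obtain ⟨r, hr⟩ := altWord_prefix_of_le hn j i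
  rw [← hr, List.append_assoc] at h hi
  have hprod : P.prod (altWord i j (P.m i j) ++ (r ++ l)) =
      P.prod (altWord j i (P.m i j) ++ (r ++ l)) := by
    rw [prod_append, prod_altWord_m hij, ← prod_append]
  have hred := h.congr hprod (by simp only [List.length_append, length_altWord])
  obtain ⟨u, hu⟩ := List.head?_eq_some_iff.mp (head?_altWord_append (P.m_pos i j) i j (r ++ l))
  rw [← hprod, hu] at hi
  rw [hu] at hred
  exact not_pos_cons_iff.mpr hred.pos_of_cons hi

end PositiveSystem

end CoxeterCombinatorics

section DeformedCartanMatrices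

variable {I K F V : Type*} [CommRing K] [AddCommGroup F] [Module K F]

/-- The relations between the parameters `p, r, x, y ∈ S` of the two-generator recursion
`DihedralSequence` that make it close up after `2`, `3`, `4` or `6` steps. For `p = r = 1` they read
`x y = 0, 1, 2, 3`, as for the four finite crystallographic Cartan matrices of rank two. -/
inductive DihedralType (S : Subsemiring K) (p r x y : K) : ℕ → Prop
  | two (hx : x = 0) (hy : y = 0) : DihedralType S p r x y 2
  | three (hp : p = r) (hxy : x * y = p) : DihedralType S p r x y 3
  | four (hxy : x * y = p + r) : DihedralType S p r x y 4
  | six (g : K) (hg : g ∈ S) (hxy : x * y = p + r + g) (hgg : g ^ 2 = p * r) :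
      DihedralType S p r x y 6

theorem DihedralType.symm {S : Subsemiring K} {p r x y : K} {m : ℕ}
    (h : DihedralType S p r x y m) : DihedralType S r p y x m := by
  cases h with
  | two hx hy => exact .two hy hx
  | three hp hxy => exact .three hp.symm (by rw [mul_comm, hxy, hp])
  | four hxy => exact .four (by rw [mul_comm, hxy, add_comm])
  | six g hg hxy hgg =>
    exact .six g hg (by rw [mul_comm, hxy, add_comm p]) (by rw [hgg, mul_comm])

/-- The recursion satisfied by the values of two deformed simple coroots on alternating products of
two deformed simple reflections. -/
structure DihedralSequence (p r x y : K) (f g : ℕ → F) : Prop where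
  left_one : f 1 = f 0 + x • g 0
  right_one : g 1 = g 0 + y • f 0
  left_add_two : ∀ n, f (n + 2) = x • g (n + 1) - p • f n
  right_add_two : ∀ n, g (n + 2) = y • f (n + 1) - r • g n

namespace DihedralSequence

variable {S : Subsemiring K} {p r x y : K} {f g : ℕ → F}

theorem symm (h : DihedralSequence p r x y f g) : DihedralSequence r p y x g f :=
  ⟨h.right_one, h.left_one, h.right_add_two, h.left_add_two⟩

theorem left_two (h : DihedralSequence p r x y f g) : f 2 = (x * y - p) • f 0 + x • g 0 := by
  rw [h.left_add_two 0, h.right_one]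
  module

theorem left_three (h : DihedralSequence p r x y f g) :
    f 3 = (x * y - p) • f 0 + (x * (x * y - p - r)) • g 0 := by
  rw [h.left_add_two 1, h.symm.left_two, h.left_one]
  module

theorem left_four (h : DihedralSequence p r x y f g) :
    f 4 = (x * y * (x * y - p - r) - p * (x * y - p)) • f 0 + (x * (x * y - p - r)) • g 0 := by
  rw [h.left_add_two 2, h.symm.left_three, h.left_two]
  module

theorem left_five (h : DihedralSequence p r x y f g) :
    f 5 = (x * y * (x * y - p - r) - p * (x * y - p)) • f 0 +
      (x * ((x * y - p) * (x * y - p - r) - r * (x * y - r))) • g 0 := by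
  rw [h.left_add_two 3, h.symm.left_four, h.left_three]
  module

theorem exists_left_eq (h : DihedralSequence p r x y f g) {m n : ℕ} (hm : DihedralType S p r x y m)
    (hn : n < m) (hr : r ∈ S) (hx : x ∈ S) :
    ∃ c ∈ S, ∃ c' ∈ S, f n = c • f 0 + c' • g 0 := by
  have h₀ : ∃ c ∈ S, ∃ c' ∈ S, f 0 = c • f 0 + c' • g 0 :=
    ⟨1, one_mem S, 0, zero_mem S, by module⟩
  have h₁ : ∃ c ∈ S, ∃ c' ∈ S, f 1 = c • f 0 + c' • g 0 :=
    ⟨1, one_mem S, x, hx, by rw [h.left_one, one_smul]⟩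
  cases hm with
  | two => interval_cases n <;> assumption
  | three hpr hxy =>
    interval_cases n
    · exact h₀
    · exact h₁
    · exact ⟨0, zero_mem S, x, hx, by rw [h.left_two, hxy, sub_self]⟩
  | four hxy =>
    have hxyp : x * y - p = r := by rw [hxy, add_sub_cancel_left]
    interval_cases n
    · exact h₀
    · exact h₁
    · exact ⟨r, hr, x, hx, by rw [h.left_two, hxyp]⟩
    · exact ⟨r, hr, 0, zero_mem S, by rw [h.left_three, hxyp, sub_self, mul_zero]⟩
  | six g hg hxy hgg =>
    have hxyp : x * y - p = r + g := by rw [hxy]; ring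
    have hxypr : x * y - p - r = g := by rw [hxyp, add_sub_cancel_left]
    have hleft : x * y * g - p * (r + g) = r * g := by rw [hxy]; linear_combination hgg
    have hright : (r + g) * g - r * (x * y - r) = 0 := by rw [hxy]; linear_combination hgg
    interval_cases n
    · exact h₀
    · exact h₁
    · exact ⟨r + g, add_mem hr hg, x, hx, by rw [h.left_two, hxyp]⟩
    · exact ⟨r + g, add_mem hr hg, x * g, mul_mem hx hg, by rw [h.left_three, hxypr, hxyp]⟩
    · exact ⟨r * g, mul_mem hr hg, x * g, mul_mem hx hg, by
        rw [h.left_four, hxypr, hxyp, hleft]⟩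
    · exact ⟨r * g, mul_mem hr hg, 0, zero_mem S, by
        rw [h.left_five, hxypr, hxyp, hleft, hright, mul_zero]⟩

theorem alternating_sum_left_eq_zero (h : DihedralSequence p r x y f g) {m : ℕ}
    (hm : DihedralType S p r x y m) : ∑ n ∈ Finset.range m, (-1 : K) ^ n • f n = 0 := by
  cases hm with
  | two hx =>
    simp only [Finset.sum_range_succ, Finset.sum_range_zero, h.left_one, hx]
    module
  | three hpr hxy =>
    simp only [Finset.sum_range_succ, Finset.sum_range_zero, h.left_one, h.left_two, hxy]
    module
  | four hxy =>
    simp only [Finset.sum_range_succ, Finset.sum_range_zero, h.left_one, h.left_two, h.left_three,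
      hxy]
    module
  | six g hg hxy hgg =>
    simp only [Finset.sum_range_succ, Finset.sum_range_zero, h.left_one, h.left_two, h.left_three,
      h.left_four, h.left_five, hxy]
    match_scalars
    · ring
    · linear_combination -x * hgg

end DihedralSequence

/-- A deformation over `K` of a generalised Cartan matrix with braid relations of lengths `m i j`:
the entries `2` on the diagonal become `1 + p` with `p ∈ S`, the off-diagonal entries are negatives
of elements of `S`, and the rank two submatrices satisfy `DihedralType`. The subsemiring `S` plays
the role of the nonnegative integers. -/
structure IsDeformedCartan (S : Subsemiring K) (A : Matrix I I K) (m : I → I → ℕ) : Prop where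
  diag_sub_one_mem : ∀ i, A i i - 1 ∈ S
  neg_mem : ∀ i j, i ≠ j → -A i j ∈ S
  dihedralType : ∀ i j, i ≠ j →
    DihedralType S (A i i - 1) (A j j - 1) (-A j i) (-A i j) (m i j)

theorem DihedralType.map {L : Type*} [CommRing L] {S : Subsemiring K} {S' : Subsemiring L}
    {p r x y : K} {m : ℕ} (h : DihedralType S p r x y m) (φ : K →+* L) (hφ : S ≤ S'.comap φ) :
    DihedralType S' (φ p) (φ r) (φ x) (φ y) m := by
  cases h with
  | two hx hy => exact .two (by rw [hx, map_zero]) (by rw [hy, map_zero])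
  | three hp hxy => exact .three (by rw [hp]) (by rw [← map_mul, hxy])
  | four hxy => exact .four (by rw [← map_mul, hxy, map_add])
  | six g hg hxy hgg =>
    exact .six (φ g) (hφ hg) (by rw [← map_mul, hxy, map_add, map_add])
      (by rw [← map_pow, hgg, map_mul])

theorem IsDeformedCartan.map {L : Type*} [CommRing L] {S : Subsemiring K} {S' : Subsemiring L}
    {A : Matrix I I K} {m : I → I → ℕ} (h : IsDeformedCartan S A m) (φ : K →+* L)
    (hφ : S ≤ S'.comap φ) : IsDeformedCartan S' (A.map φ) m where
  diag_sub_one_mem i := by simpa using hφ (h.diag_sub_one_mem i)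
  neg_mem i j hij := by simpa using hφ (h.neg_mem i j hij)
  dihedralType i j hij := by simpa using (h.dihedralType i j hij).map φ hφ

/-- The maps `T i` change the coordinates `φ j` as reflections with matrix `A` do, as in
`⟨s_i v, α_j^∨⟩ = ⟨v, α_j^∨⟩ - ⟨α_i, α_j^∨⟩ ⟨v, α_i^∨⟩`. -/
def IsReflectionFamily (A : Matrix I I K) (φ : I → V → F) (T : I → V → V) : Prop :=
  ∀ i j v, φ j (T i v) = φ j v - A i j • φ i v

namespace IsReflectionFamily

variable {S : Subsemiring K} {A : Matrix I I K} {m : I → I → ℕ} {φ : I → V → F} {T : I → V → V}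

theorem apply_altWord_succ (hT : IsReflectionFamily A φ T) (i j k : I) (n : ℕ) (v : V) :
    φ k ((altWord i j (n + 1)).foldr T v) =
      φ k ((altWord j i n).foldr T v) - A i k • φ i ((altWord j i n).foldr T v) :=
  hT i k _

theorem dihedralSequence (hT : IsReflectionFamily A φ T) (i j : I) :
    DihedralSequence (A i i - 1) (A j j - 1) (-A j i) (-A i j)
      (fun n v => φ i ((altWord j i n).foldr T v))
      (fun n v => φ j ((altWord i j n).foldr T v)) := by
  have one (i j : I) (v : V) : φ i ((altWord j i 1).foldr T v) =
      φ i ((altWord j i 0).foldr T v) + -A j i • φ j ((altWord i j 0).foldr T v) := by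
    rw [neg_smul, ← sub_eq_add_neg]
    exact hT j i v
  have add_two (i j : I) (n : ℕ) (v : V) : φ i ((altWord j i (n + 2)).foldr T v) =
      -A j i • φ j ((altWord i j (n + 1)).foldr T v) -
        (A i i - 1) • φ i ((altWord j i n).foldr T v) := by
    rw [hT.apply_altWord_succ j i i (n + 1), hT.apply_altWord_succ i j i n]
    module
  exact ⟨funext (one i j), funext (one j i), fun n => funext (add_two i j n),
    fun n => funext (add_two j i n)⟩

theorem exists_apply_altWord (hT : IsReflectionFamily A φ T) (hA : IsDeformedCartan S A m)
    {i j : I} (hij : i ≠ j) {n : ℕ} (hn : n < m i j) :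
    ∃ c ∈ S, ∃ c' ∈ S, ∀ v, φ i ((altWord j i n).foldr T v) = c • φ i v + c' • φ j v := by
  obtain ⟨c, hc, c', hc', h⟩ := (hT.dihedralSequence i j).exists_left_eq
    (hA.dihedralType i j hij) hn (hA.diag_sub_one_mem j) (hA.neg_mem j i hij.symm)
  exact ⟨c, hc, c', hc', congrFun h⟩

theorem apply_altWord_sub_apply_altWord (hT : IsReflectionFamily A φ T) (i j k : I) (n : ℕ)
    (v : V) :
    (-1 : K) ^ n • (φ k ((altWord i j n).foldr T v) - φ k ((altWord j i n).foldr T v)) =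
      A i k • ∑ l ∈ Finset.range n, (-1 : K) ^ l • φ i ((altWord j i l).foldr T v) -
        A j k • ∑ l ∈ Finset.range n, (-1 : K) ^ l • φ j ((altWord i j l).foldr T v) := by
  induction n with
  | zero => simp [altWord]
  | succ n ih =>
    rw [Finset.sum_range_succ, Finset.sum_range_succ, hT.apply_altWord_succ i j,
      hT.apply_altWord_succ j i]
    linear_combination (norm := module) ih

theorem apply_altWord_comm (hT : IsReflectionFamily A φ T) (hA : IsDeformedCartan S A m)
    {i j : I} (hij : i ≠ j) (k : I) (v : V) :
    φ k ((altWord i j (m i j)).foldr T v) = φ k ((altWord j i (m i j)).foldr T v) := by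
  have h := hT.apply_altWord_sub_apply_altWord i j k (m i j) v
  have hseq := hT.dihedralSequence i j
  have hi := congrFun (hseq.alternating_sum_left_eq_zero (hA.dihedralType i j hij)) v
  have hj := congrFun (hseq.symm.alternating_sum_left_eq_zero (hA.dihedralType i j hij).symm) v
  simp only [Finset.sum_apply, Pi.smul_apply, Pi.zero_apply] at hi hj
  rw [hi, hj, smul_zero, smul_zero, sub_zero] at h
  exact sub_eq_zero.mp (((isUnit_neg_one.pow _).smul_eq_zero).mp h)

theorem foldr_altWord_comm (hT : IsReflectionFamily A φ T) (hA : IsDeformedCartan S A m)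
    (hφ : ∀ u v, (∀ k, φ k u = φ k v) → u = v) {i j : I} (hij : i ≠ j) (v : V) :
    (altWord i j (m i j)).foldr T v = (altWord j i (m i j)).foldr T v :=
  hφ _ _ fun k => hT.apply_altWord_comm hA hij k v

/-- Strip from `l` its longest alternating prefix in `i` and the first letter of `l`: what remains
lies in the positive half-spaces of both letters, and the prefix is handled by the rank two case. -/
theorem apply_foldr_mem {G : Type*} [Group G] (P : PositiveSystem I G)
    (hT : IsReflectionFamily A φ T) (hA : IsDeformedCartan S A P.m)
    (hφ : ∀ u v, (∀ k, φ k u = φ k v) → u = v) {Q : AddSubmonoid F}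
    (hQ : ∀ c ∈ S, ∀ x ∈ Q, c • x ∈ Q) {v : V} (hv : ∀ i, φ i v ∈ Q) {l : List I}
    (hl : P.IsReduced l) {i : I} (hi : P.Pos i (P.prod l)) : φ i (l.foldr T v) ∈ Q := by
  induction hr : l.length using Nat.strong_induction_on generalizing l i with
  | _ r ih =>
    cases l with
    | nil => exact hv i
    | cons j l =>
      have hj : ¬ P.Pos j (P.prod (j :: l)) := PositiveSystem.not_pos_cons_iff.mpr hl.pos_of_cons
      have hij : i ≠ j := fun h => hj (h ▸ hi)
      obtain ⟨n, l₀, hlen, hprod, hi₀, hj₀⟩ :=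
        PositiveSystem.exists_altWord_append_of_pos (j := j) hi
      have hred : P.IsReduced (altWord j i n ++ l₀) := hl.congr hprod (by
        rw [List.length_append, length_altWord, add_comm, hlen])
      have hn : n ≠ 0 := by
        rintro rfl
        exact hj (hprod ▸ hj₀)
      obtain ⟨c, hc, c', hc', h⟩ :=
        hT.exists_apply_altWord hA hij (hred.lt_m_of_pos hij (hprod ▸ hi))
      rw [hl.matsumoto (fun _ _ v hij => hT.foldr_altWord_comm hA hφ hij v) hred hprod.symm,
        List.foldr_append, h]
      exact add_mem (hQ c hc _ (ih _ (by omega) hred.of_append hi₀ rfl))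
        (hQ c' hc' _ (ih _ (by omega) hred.of_append hj₀ rfl))

end IsReflectionFamily

end DeformedCartanMatrices

section WeylGroup

theorem prod_map_smul_eq_foldr {I G V : Type*} [Monoid G] [MulAction G V] (s : I → G) (l : List I)
    (v : V) : (l.map s).prod • v = l.foldr (fun i v => s i • v) v := by
  induction l with
  | nil => exact one_smul G v
  | cons i l ih => rw [List.map_cons, List.prod_cons, mul_smul, ih, List.foldr_cons]

variable {ι k M N : Type*} [CommRing k] [AddCommGroup M] [Module k M]
  [AddCommGroup N] [Module k N] {R : RootPairing ι k M N}

theorem coroot'_weylGroupToPerm_inv (w : R.weylGroup) (i : ι) (x : M) :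
    R.coroot' (R.weylGroupToPerm w⁻¹ i) x = R.coroot' i (w • x) := by
  have htranspose := RootPairing.Hom.weight_coweight_transpose_apply R R (R.coroot i)
    (w : R.Aut).toHom
  rw [RootPairing.Hom.coroot_coweightMap_apply] at htranspose
  rw [map_inv]
  exact (LinearMap.congr_fun htranspose x).symm

theorem weylGroup_ext {w w' : R.weylGroup} (h : ∀ x : M, w • x = w' • x) : w = w' :=
  Subtype.ext (RootPairing.Equiv.weightHom_injective R (LinearEquiv.ext h))

theorem ofIdx_smul_eq_sub (i : ι) (x : M) :
    RootPairing.weylGroup.ofIdx R i • x = x - R.coroot' i x • R.root i :=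
  R.reflection_apply i x

theorem ofIdx_mul_self (i : ι) :
    RootPairing.weylGroup.ofIdx R i * RootPairing.weylGroup.ofIdx R i = 1 := by
  apply weylGroup_ext
  intro x
  rw [mul_smul, one_smul]
  exact R.reflection_same i x

theorem mul_ofIdx (w : R.weylGroup) (i : ι) :
    w * RootPairing.weylGroup.ofIdx R i =
      RootPairing.weylGroup.ofIdx R (R.weylGroupToPerm w i) * w := by
  apply weylGroup_ext
  intro x
  rw [mul_smul, mul_smul, ofIdx_smul_eq_sub, ofIdx_smul_eq_sub, smul_sub, smul_comm w,
    RootPairing.weylGroup_apply_root, ← coroot'_weylGroupToPerm_inv, ← Equiv.Perm.mul_apply,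
    ← map_mul, inv_mul_cancel, map_one, Equiv.Perm.one_apply]

theorem weylGroupToPerm_ofIdx (i : ι) :
    R.weylGroupToPerm (RootPairing.weylGroup.ofIdx R i) = R.reflectionPerm i :=
  RootPairing.Equiv.reflection_indexEquiv R i

theorem weylGroupToPerm_mul_ofIdx_inv (w : R.weylGroup) (i j : ι) :
    R.weylGroupToPerm (w * RootPairing.weylGroup.ofIdx R j)⁻¹ i =
      R.reflectionPerm j (R.weylGroupToPerm w⁻¹ i) := by
  rw [mul_inv_rev, inv_eq_of_mul_eq_one_right (ofIdx_mul_self j), map_mul, weylGroupToPerm_ofIdx,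
    Equiv.Perm.mul_apply]

theorem weylGroupToPerm_ofIdx_mul_inv (w : R.weylGroup) (i : ι) :
    R.weylGroupToPerm (RootPairing.weylGroup.ofIdx R i * w)⁻¹ i =
      R.reflectionPerm (R.weylGroupToPerm w⁻¹ i) (R.weylGroupToPerm w⁻¹ i) := by
  rw [← weylGroupToPerm_mul_ofIdx_inv, mul_ofIdx, ← Equiv.Perm.mul_apply, ← map_mul,
    mul_inv_cancel, map_one, Equiv.Perm.one_apply]

theorem eq_of_forall_coroot'_eq [R.IsRootSystem] (b : R.Base) {x y : M}
    (h : ∀ i : b.support, R.coroot' i x = R.coroot' i y) : x = y := by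
  have hspan : Submodule.span k (R.coroot '' b.support) = ⊤ := by
    rw [b.span_coroot_support, RootPairing.corootSpan, RootPairing.IsRootSystem.span_coroot_eq_top]
  refine (LinearMap.IsPerfPair.bijective_left R.toLinearMap).injective (LinearMap.ext_on hspan ?_)
  rintro _ ⟨i, hi, rfl⟩
  exact h ⟨i, hi⟩

theorem isReflectionFamily_ofIdx [CharZero k] [R.IsCrystallographic] (b : R.Base) :
    IsReflectionFamily b.cartanMatrix (fun i : b.support => (R.coroot' i : M → k))
      (fun i x => RootPairing.weylGroup.ofIdx R i • x) := by
  intro i j x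
  have hpairing : R.coroot' j (R.root i) = (b.cartanMatrix i j : k) :=
    (b.algebraMap_cartanMatrixIn_apply ℤ i j).symm
  change R.coroot' j (RootPairing.weylGroup.ofIdx R i • x) = _
  rw [ofIdx_smul_eq_sub, map_sub, map_smul, hpairing, smul_eq_mul, mul_comm, zsmul_eq_mul]

theorem isPos_of_root_eq [CharZero k] [R.IsReduced] {b : R.Base} {a : ι} {i j : b.support}
    {c c' : ℤ} (hc : 0 ≤ c) (hc' : 0 ≤ c') (h : R.root a = c • R.root i + c' • R.root j) :
    b.IsPos a := by
  classical
  have hroot : R.root a =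
      ∑ l ∈ b.support, (Pi.single (i : ι) c + Pi.single (j : ι) c' : ι → ℤ) l • R.root l := by
    simp only [Pi.add_apply, add_smul, Finset.sum_add_distrib, Pi.single_apply, ite_smul, zero_smul,
      Finset.sum_ite_eq', i.2, j.2, if_true, h]
  rw [RootPairing.Base.isPos_iff', b.height_eq_sum hroot]
  have hi : (0 : ι → ℤ) ≤ Pi.single (i : ι) c := Pi.single_nonneg.mpr hc
  have hj : (0 : ι → ℤ) ≤ Pi.single (j : ι) c' := Pi.single_nonneg.mpr hc'
  exact Finset.sum_nonneg fun l _ => add_nonneg (hi l) (hj l)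

/-- A root is positive when its coroot is a nonnegative combination of simple coroots, whence the
flipped base. -/
def weylPositiveSystem [CharZero k] [IsDomain k] [Module.IsTorsionFree k M]
    [Module.IsTorsionFree k N] [Finite ι] [R.IsRootSystem] [R.IsCrystallographic] [R.IsReduced]
    (b : R.Base) (m : b.support → b.support → ℕ) (m_symm : ∀ i j, m i j = m j i)
    (m_pos : ∀ i j, 0 < m i j)
    (hA : IsDeformedCartan (Subsemiring.nonneg ℤ) b.cartanMatrix m) :
    PositiveSystem b.support R.weylGroup where
  s i := RootPairing.weylGroup.ofIdx R i
  Pos i w := b.flip.IsPos (R.weylGroupToPerm w⁻¹ i)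
  m := m
  s_mul_self i := ofIdx_mul_self (R := R) i
  pos_one i := by
    rw [inv_one, map_one]
    exact b.flip.isPos_of_mem_support i.2
  pos_s_mul_iff i w := by
    rw [weylGroupToPerm_ofIdx_mul_inv]
    exact RootPairing.Base.IsPos.neg_iff_not b.flip _
  exchange i j w hi hj := by
    rw [weylGroupToPerm_mul_ofIdx_inv] at hj
    have heq : R.weylGroupToPerm w⁻¹ i = j := by
      by_contra hne
      exact hj (hi.reflectionPerm j.2 hne)
    rw [mul_ofIdx, ← heq, ← Equiv.Perm.mul_apply, ← map_mul, mul_inv_cancel, map_one,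
      Equiv.Perm.one_apply]
  m_symm := m_symm
  m_pos := m_pos
  braid i j hij := by
    apply weylGroup_ext
    intro x
    rw [prod_map_smul_eq_foldr, prod_map_smul_eq_foldr]
    exact (isReflectionFamily_ofIdx b).foldr_altWord_comm hA
      (fun _ _ => eq_of_forall_coroot'_eq b) hij x
  pos_altWord i j n hij hn := by
    obtain ⟨c, hc, c', hc', h⟩ := (isReflectionFamily_ofIdx b).exists_apply_altWord hA hij hn
    refine isPos_of_root_eq (R := R.flip) (i := i) (j := j) hc hc' ?_
    apply (LinearMap.IsPerfPair.bijective_right R.toLinearMap).injective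
    ext x
    rw [map_add, map_zsmul, map_zsmul]
    refine (coroot'_weylGroupToPerm_inv _ _ x).trans ?_
    rw [prod_map_smul_eq_foldr]
    exact h x

end WeylGroup

section QuantumCartanMatrix

variable {I : Type*} {A : Matrix I I ℤ} {d : I → ℕ}

/-- The pairs of off-diagonal entries `(a i j, a j i)` of the Cartan matrices of finite type of rank
two. -/
def finiteTypePairs : Set (ℤ × ℤ) := {(0, 0), (-1, -1), (-1, -2), (-2, -1), (-1, -3), (-3, -1)}

/-- The order of the product of two simple reflections in the Weyl group of a Cartan matrix of
finite type; this is the length of the corresponding braid relation. -/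
def braidLength (A : Matrix I I ℤ) (i j : I) : ℕ :=
  match A i j * A j i with
  | 0 => 2
  | 1 => 3
  | 2 => 4
  | _ => 6

theorem braidLength_comm (i j : I) : braidLength A i j = braidLength A j i := by
  rw [braidLength, braidLength, mul_comm]

theorem braidLength_pos (i j : I) : 0 < braidLength A i j := by
  unfold braidLength
  split <;> norm_num

/-- The polynomials in `X` with nonnegative integer coefficients. -/
def natPolynomials : Subsemiring ℤ[X] := Subsemiring.closure {X}

theorem X_mem_natPolynomials : X ∈ natPolynomials := Subsemiring.subset_closure rfl

theorem natPolynomials_le_comap_eval_one :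
    natPolynomials ≤ (Subsemiring.nonneg ℤ).comap (evalRingHom 1) := by
  rw [natPolynomials, Subsemiring.closure_le, Set.singleton_subset_iff]
  simp

variable [DecidableEq I]

/-- The matrix over `ℤ[q]` by which `T̃_i` acts on `𝒫`, written additively, when `q` acts as
`ϖ(u) ↦ ϖ(q u)`. It deforms the transpose of `A`, the indeterminate being `q`. -/
def quantumCartan (A : Matrix I I ℤ) (d : I → ℕ) : Matrix I I ℤ[X] := .of fun i j =>
  if j = i then 1 + (X ^ d i) ^ 2
  else if A j i = -1 then -X ^ d i
  else if A j i = -2 then -(X ^ 3 + X)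
  else if A j i = -3 then -(X ^ 5 + X ^ 3 + X)
  else 0

theorem quantumCartan_self (i : I) : quantumCartan A d i i = 1 + (X ^ d i) ^ 2 := if_pos rfl

theorem quantumCartan_of_ne {i j : I} (hij : i ≠ j) : quantumCartan A d i j =
    if A j i = -1 then -X ^ d i
    else if A j i = -2 then -(X ^ 3 + X)
    else if A j i = -3 then -(X ^ 5 + X ^ 3 + X)
    else 0 := if_neg hij.symm

theorem neg_quantumCartan_mem {i j : I} (hij : i ≠ j) :
    -quantumCartan A d i j ∈ natPolynomials := by
  have hX := X_mem_natPolynomials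
  rw [quantumCartan_of_ne hij]
  split_ifs
  · rw [neg_neg]
    exact pow_mem hX _
  · rw [neg_neg]
    exact add_mem (pow_mem hX _) hX
  · rw [neg_neg]
    exact add_mem (add_mem (pow_mem hX _) (pow_mem hX _)) hX
  · rw [neg_zero]
    exact zero_mem _

theorem dihedralType_quantumCartan {i j : I} (hij : i ≠ j)
    (hpair : (A i j, A j i) ∈ finiteTypePairs)
    (hsymm : (d i : ℤ) * A i j = d j * A j i) (hi : A i j < -1 → d i = 1)
    (hj : A j i < -1 → d j = 1) :
    DihedralType natPolynomials ((X ^ d i) ^ 2) ((X ^ d j) ^ 2) (-quantumCartan A d j i)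
      (-quantumCartan A d i j) (braidLength A i j) := by
  have hg : (X ^ 4 : ℤ[X]) ∈ natPolynomials := pow_mem X_mem_natPolynomials 4
  simp only [finiteTypePairs, Set.mem_insert_iff, Set.mem_singleton_iff, Prod.mk.injEq] at hpair
  rw [quantumCartan_of_ne hij, quantumCartan_of_ne hij.symm, braidLength]
  rcases hpair with ⟨h, h'⟩ | ⟨h, h'⟩ | ⟨h, h'⟩ | ⟨h, h'⟩ | ⟨h, h'⟩ | ⟨h, h'⟩ <;>
    rw [h, h'] at hsymm ⊢ <;> norm_num only [if_true, if_false, neg_neg]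
  · exact .two neg_zero neg_zero
  · have hd : d i = d j := by omega
    rw [hd]
    exact .three rfl (sq _).symm
  · have hdj := hj (by omega)
    have hdi : d i = 2 := by omega
    rw [hdi, hdj]
    exact .four (by ring)
  · have hdi := hi (by omega)
    have hdj : d j = 2 := by omega
    rw [hdi, hdj]
    exact .four (by ring)
  · have hdj := hj (by omega)
    have hdi : d i = 3 := by omega
    rw [hdi, hdj]
    exact .six (X ^ 4) hg (by ring) (by ring)
  · have hdi := hi (by omega)
    have hdj : d j = 3 := by omega
    rw [hdi, hdj]
    exact .six (X ^ 4) hg (by ring) (by ring)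

theorem isDeformedCartan_quantumCartan
    (hpair : ∀ i j, i ≠ j → (A i j, A j i) ∈ finiteTypePairs)
    (hsymm : ∀ i j, (d i : ℤ) * A i j = d j * A j i) (hnorm : ∀ i j, A j i < -1 → d j = 1) :
    IsDeformedCartan natPolynomials (quantumCartan A d) (braidLength A) where
  diag_sub_one_mem i := by
    rw [quantumCartan_self, add_sub_cancel_left]
    exact pow_mem (pow_mem X_mem_natPolynomials _) _
  neg_mem i j hij := neg_quantumCartan_mem hij
  dihedralType i j hij := by
    rw [quantumCartan_self, quantumCartan_self, add_sub_cancel_left, add_sub_cancel_left]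
    exact dihedralType_quantumCartan hij (hpair i j hij) (hsymm i j) (hnorm j i) (hnorm i j)

theorem quantumCartan_map_eval_one (hdiag : ∀ i, A i i = 2)
    (hpair : ∀ i j, i ≠ j → (A i j, A j i) ∈ finiteTypePairs) :
    (quantumCartan A d).map (evalRingHom 1) = A.transpose := by
  ext i j
  rw [Matrix.map_apply, Matrix.transpose_apply]
  rcases eq_or_ne i j with rfl | hij
  · rw [quantumCartan_self, hdiag]
    simp
  · have h := hpair i j hij
    rw [quantumCartan_of_ne hij]
    simp only [finiteTypePairs, Set.mem_insert_iff, Set.mem_singleton_iff, Prod.mk.injEq] at h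
    split_ifs with h₁ h₂ h₃
    · simp [h₁]
    · simp [h₂]
    · simp [h₃]
    · rw [map_zero]
      omega

end QuantumCartanMatrix

section EllWeightModule

theorem dilate_mul (a b : ℂˣ) (x : RatFunc ℂ) : dilate (a * b) x = dilate a (dilate b x) := by
  have hpoly (p : ℂ[X]) :
      dilate (a * b) (algebraMap _ _ p) = dilate a (dilate b (algebraMap _ _ p)) := by
    rw [dilate_algebraMap, dilate_algebraMap, dilate_algebraMap, comp_assoc]
    simp only [mul_comp, C_comp, X_comp, Units.val_mul, C_mul]
    ring_nf
  rw [← RatFunc.num_div_denom x, map_div₀, map_div₀, map_div₀, hpoly, hpoly]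

theorem dilate_one (x : RatFunc ℂ) : dilate 1 x = x := by
  have hpoly (p : ℂ[X]) : dilate 1 (algebraMap _ _ p) = algebraMap _ _ p := by
    rw [dilate_algebraMap, Units.val_one, C_1, one_mul, comp_X]
  rw [← RatFunc.num_div_denom x, map_div₀, hpoly, hpoly]

/-- The map `ϖ(u) ↦ ϖ(q u)` on non-zero rational functions, written additively. -/
def dilateLinear (q : ℂˣ) : Additive (RatFunc ℂ)ˣ →ₗ[ℤ] Additive (RatFunc ℂ)ˣ :=
  (dilateUnits q).toAdditive.toIntLinearMap

theorem dilateLinear_pow_ofMul (q : ℂˣ) (n : ℕ) (x : (RatFunc ℂ)ˣ) :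
    (dilateLinear q ^ n) (.ofMul x) = .ofMul (dilateUnits (q ^ n) x) := by
  induction n with
  | zero => exact congrArg Additive.ofMul (Units.ext (dilate_one _).symm)
  | succ n ih =>
    rw [pow_succ', Module.End.mul_apply, ih, pow_succ']
    exact congrArg Additive.ofMul (Units.ext (dilate_mul _ _ _).symm)

/-- The non-zero rational functions, written additively, as a module over `ℤ[X]` in which `X` acts
as `ϖ(u) ↦ ϖ(q u)`. -/
abbrev EllModule (q : ℂˣ) : Type := Module.AEval' (dilateLinear q)

/-- A non-zero rational function as an element of `EllModule q`. -/
def toEllModule (q : ℂˣ) (x : (RatFunc ℂ)ˣ) : EllModule q := Module.AEval'.of _ (.ofMul x)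

theorem toEllModule_injective (q : ℂˣ) : Function.Injective (toEllModule q) := fun _ _ h =>
  Additive.ofMul.injective ((Module.AEval'.of _).injective h)

theorem toEllModule_mul (q : ℂˣ) (x y : (RatFunc ℂ)ˣ) :
    toEllModule q (x * y) = toEllModule q x + toEllModule q y := map_add (Module.AEval'.of _) _ _

theorem toEllModule_inv (q : ℂˣ) (x : (RatFunc ℂ)ˣ) :
    toEllModule q x⁻¹ = -toEllModule q x := map_neg (Module.AEval'.of _) _

theorem X_pow_smul_toEllModule (q : ℂˣ) (n : ℕ) (x : (RatFunc ℂ)ˣ) :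
    (X ^ n : ℤ[X]) • toEllModule q x = toEllModule q (dilateUnits (q ^ n) x) :=
  (Module.AEval'.X_pow_smul_of _ _ n).trans (congrArg _ (dilateLinear_pow_ofMul q n x))

theorem X_smul_toEllModule (q : ℂˣ) (x : (RatFunc ℂ)ˣ) :
    (X : ℤ[X]) • toEllModule q x = toEllModule q (dilateUnits q x) := Module.AEval'.X_smul_of _ _

/-- The polynomials with constant term one, as a submonoid of the non-zero rational functions. -/
def polyUnits : Submonoid (RatFunc ℂ)ˣ where
  carrier := {x | ∃ p : ℂ[X], p.coeff 0 = 1 ∧ (x : RatFunc ℂ) = algebraMap ℂ[X] (RatFunc ℂ) p}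
  one_mem' := ⟨1, coeff_one_zero, by rw [Units.val_one, map_one]⟩
  mul_mem' := by
    rintro x y ⟨p, hp, hp'⟩ ⟨r, hr, hr'⟩
    exact ⟨p * r, by rw [mul_coeff_zero, hp, hr, one_mul], by rw [Units.val_mul, hp', hr', map_mul]⟩

theorem dilateUnits_mem_polyUnits (c : ℂˣ) {x : (RatFunc ℂ)ˣ} (hx : x ∈ polyUnits) :
    dilateUnits c x ∈ polyUnits := by
  obtain ⟨p, hp, hp'⟩ := hx
  refine ⟨p.comp (C (c : ℂ) * X), ?_, ?_⟩
  · rw [coeff_zero_eq_eval_zero] at hp ⊢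
    rwa [eval_comp, eval_mul, eval_X, mul_zero]
  · rw [← dilate_algebraMap, ← hp']
    rfl

/-- `polyUnits` as a submonoid of `EllModule q`. -/
def polySubmonoid (q : ℂˣ) : AddSubmonoid (EllModule q) :=
  polyUnits.toAddSubmonoid.map (Module.AEval'.of (dilateLinear q)).toAddMonoidHom

theorem toEllModule_mem_polySubmonoid {q : ℂˣ} {x : (RatFunc ℂ)ˣ} :
    toEllModule q x ∈ polySubmonoid q ↔ x ∈ polyUnits :=
  AddSubmonoid.mem_map_iff_mem (Module.AEval'.of (dilateLinear q)).injective

theorem smul_mem_polySubmonoid (q : ℂˣ) : ∀ c ∈ natPolynomials, ∀ x ∈ polySubmonoid q,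
    c • x ∈ polySubmonoid q := by
  intro c hc
  induction hc using Subsemiring.closure_induction with
  | mem c hc =>
    rintro _ ⟨x, hx, rfl⟩
    rw [Set.mem_singleton_iff.mp hc]
    exact ⟨_, dilateUnits_mem_polyUnits q hx, (X_smul_toEllModule q x.toMul).symm⟩
  | zero => exact fun x _ => (zero_smul ℤ[X] x).symm ▸ zero_mem _
  | one => exact fun x hx => (one_smul ℤ[X] x).symm ▸ hx
  | add a b _ _ ha hb => exact fun x hx => (add_smul a b x).symm ▸ add_mem (ha x hx) (hb x hx)
  | mul a b _ _ ha hb => exact fun x hx => (mul_smul a b x).symm ▸ ha _ (hb x hx)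

variable {I : Type*} [DecidableEq I] (A : Matrix I I ℤ) (d : I → ℕ) (q : ℂˣ)

theorem isReflectionFamily_braid : IsReflectionFamily (quantumCartan A d)
    (fun i (ϖ : ellWeights I) => toEllModule q ((ϖ : I → (RatFunc ℂ)ˣ) i))
    (fun i => braid A d q i) := by
  intro i j ϖ
  change toEllModule q (braidFun A d q i ϖ j) = _
  unfold braidFun
  beta_reduce
  rcases eq_or_ne j i with rfl | hj
  · rw [if_pos rfl, quantumCartan_self, toEllModule_inv, add_smul, one_smul, ← pow_mul,
      ← pow_mul, X_pow_smul_toEllModule]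
    abel
  · rw [if_neg hj, quantumCartan_of_ne hj.symm]
    split_ifs
    · rw [toEllModule_mul, neg_smul, X_pow_smul_toEllModule, sub_neg_eq_add]
    · rw [toEllModule_mul, toEllModule_mul, neg_smul, add_smul, X_pow_smul_toEllModule,
        X_smul_toEllModule, sub_neg_eq_add, add_assoc]
    · rw [toEllModule_mul, toEllModule_mul, toEllModule_mul, neg_smul, add_smul, add_smul,
        X_pow_smul_toEllModule, X_pow_smul_toEllModule, X_smul_toEllModule, sub_neg_eq_add,
        add_assoc, add_assoc, add_assoc]
    · rw [zero_smul]
      exact (sub_zero (toEllModule q (ϖ.1 j))).symm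

end EllWeightModule

section PartialOrder

theorem mem_closure_one_sub_C_mul_X {K : Type*} [Field K] {p : K[X]} (hp : p.Splits)
    (hp₀ : p.coeff 0 = 1) :
    p ∈ Submonoid.closure (Set.range fun a : Kˣ => 1 - C (a : K) * X) := by
  suffices h : p.coeff 0 ≠ 0 → C (p.coeff 0)⁻¹ * p ∈
      Submonoid.closure (Set.range fun a : Kˣ => 1 - C (a : K) * X) by
    simpa [hp₀] using h
  clear hp₀
  induction hp using Submonoid.closure_induction with
  | one => simp
  | mul p r _ _ ihp ihr =>
    rw [mul_coeff_zero, mul_ne_zero_iff, mul_inv, C_mul, mul_mul_mul_comm]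
    exact fun h => mul_mem (ihp h.1) (ihr h.2)
  | mem p hp =>
    rcases hp with ⟨a, rfl⟩ | ⟨a, rfl⟩
    · rw [coeff_C_zero]
      exact fun ha => by simp [← C_mul, ha]
    · rw [coeff_add, coeff_X_zero, coeff_C_zero, zero_add]
      refine fun ha => Submonoid.subset_closure ⟨-(Units.mk0 a ha)⁻¹, ?_⟩
      simp [mul_add, ← C_mul, ha, add_comm]

variable {I : Type*} [DecidableEq I] {A : Matrix I I ℤ} {d : I → ℕ} {q : ℂˣ}

theorem exists_apply_eq_of_mem_polyUnits (i : I) {x : (RatFunc ℂ)ˣ} (hx : x ∈ polyUnits) :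
    ∃ ϖ : ellWeights I, (ϖ : I → (RatFunc ℂ)ˣ) i = x ∧
      (braid A d q i ϖ)⁻¹ * ϖ ∈ ellRootsPos A d q := by
  obtain ⟨p, hp, hxp⟩ := hx
  have hmem := mem_closure_one_sub_C_mul_X (IsAlgClosed.splits p) hp
  clear hp
  induction hmem using Submonoid.closure_induction generalizing x with
  | one => exact ⟨1, Units.ext (by rw [hxp, map_one]; rfl), by simp⟩
  | mem p hp =>
    obtain ⟨a, rfl⟩ := hp
    refine ⟨fund i a, Units.ext ?_, Submonoid.subset_closure ⟨i, a, rfl⟩⟩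
    simp [hxp, fund, fundTuple]
  | mul p r _ _ ihp ihr =>
    have hne : algebraMap ℂ[X] (RatFunc ℂ) p * algebraMap ℂ[X] (RatFunc ℂ) r ≠ 0 := by
      rw [← map_mul, ← hxp]
      exact x.ne_zero
    obtain ⟨ϖ, hϖ, hm⟩ := ihp (x := Units.mk0 _ (left_ne_zero_of_mul hne)) rfl
    obtain ⟨ϖ', hϖ', hm'⟩ := ihr (x := Units.mk0 _ (right_ne_zero_of_mul hne)) rfl
    refine ⟨ϖ * ϖ', Units.ext ?_, ?_⟩
    · rw [Subgroup.coe_mul, Pi.mul_apply, hϖ, hϖ', hxp, map_mul]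
      rfl
    · rw [map_mul, mul_inv, mul_mul_mul_comm]
      exact mul_mem hm hm'

theorem braid_eq_self {i : I} {ϖ : ellWeights I} (hϖ : (ϖ : I → (RatFunc ℂ)ˣ) i = 1) :
    braid A d q i ϖ = ϖ := by
  apply Subtype.ext
  funext j
  change braidFun A d q i ϖ j = _
  unfold braidFun
  split_ifs with h
  · rw [h, hϖ, map_one, inv_one]
  all_goals simp only [hϖ, map_one, mul_one]

theorem ellLE_refl (ϖ : ellWeights I) : ellLE A d q ϖ ϖ := ⟨1, one_mem _, (mul_one _).symm⟩

theorem ellLE.trans {ϖ ϖ' ϖ'' : ellWeights I} (h : ellLE A d q ϖ ϖ') (h' : ellLE A d q ϖ' ϖ'') :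
    ellLE A d q ϖ ϖ'' := by
  obtain ⟨β, hβ, rfl⟩ := h
  obtain ⟨γ, hγ, rfl⟩ := h'
  exact ⟨γ * β, mul_mem hγ hβ, mul_assoc _ _ _⟩

/-- Modulo the fixed points of `T̃_i`, the tuple `ϖ` is a product of fundamental ℓ-weights
`π_{i,a}`, for which `T̃_i π_{i,a} = π_{i,a} α_{i,a}⁻¹`. -/
theorem ellLE_braid {i : I} {ϖ : ellWeights I} (h : (ϖ : I → (RatFunc ℂ)ˣ) i ∈ polyUnits) :
    ellLE A d q (braid A d q i ϖ) ϖ := by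
  obtain ⟨ϖ', hϖ', hmem⟩ := exists_apply_eq_of_mem_polyUnits (A := A) (d := d) (q := q) i h
  have hfix : braid A d q i (ϖ * ϖ'⁻¹) = ϖ * ϖ'⁻¹ := braid_eq_self (by
    rw [Subgroup.coe_mul, Pi.mul_apply, Subgroup.coe_inv, Pi.inv_apply, hϖ', mul_inv_cancel])
  rw [map_mul, map_inv, mul_inv_eq_iff_eq_mul] at hfix
  refine ⟨_, ⟨_, hmem, rfl⟩, ?_⟩
  rw [hfix, coe_invMonoidHom, mul_inv, inv_inv, mul_assoc, mul_comm ϖ'⁻¹]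

theorem braidWord_eq_foldr (l : List I) (ϖ : ellWeights I) :
    braidWord A d q l ϖ = l.foldr (fun i => braid A d q i) ϖ := by
  induction l with
  | nil => rfl
  | cons i l ih =>
    rw [braidWord, List.map_cons, List.prod_cons, List.foldr_cons, ← ih]
    rfl

theorem ellLE_braidWord {G : Type*} [Group G] (P : PositiveSystem I G)
    (hA : IsDeformedCartan natPolynomials (quantumCartan A d) P.m) {π : ellWeights I}
    (hπ : π ∈ dominant I) {l : List I} (hl : P.IsReduced l) :
    ellLE A d q (braidWord A d q l π) π := by
  rw [braidWord_eq_foldr]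
  induction l with
  | nil => exact ellLE_refl π
  | cons i l ih =>
    refine (ellLE_braid ?_).trans (ih hl.of_cons)
    rw [← toEllModule_mem_polySubmonoid (q := q)]
    refine (isReflectionFamily_braid A d q).apply_foldr_mem P hA
      (fun ϖ ϖ' h => Subtype.ext (funext fun i => toEllModule_injective q (h i)))
      (smul_mem_polySubmonoid q) (fun i => toEllModule_mem_polySubmonoid.mpr (hπ i)) hl.of_cons
      hl.pos_of_cons

end PartialOrder

section Transfer

variable {ι k M N : Type*} [Field k] [AddCommGroup M] [Module k M]
  [AddCommGroup N] [Module k N] {R : RootPairing ι k M N}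

/-- In the definition of `simpleWord` the list `l` is coerced to `List ι` monadically. -/
theorem simpleWord_eq_prod_map (b : R.Base) (l : List b.support) :
    simpleWord b l = (l.map fun i : b.support => RootPairing.weylGroup.ofIdx R i).prod := by
  simp only [simpleWord, List.pure_def, List.bind_eq_flatMap, List.flatMap_subtype,
    List.flatMap_singleton', List.map_subtype]

variable [Finite ι] [CharZero k] [R.IsCrystallographic] [R.IsReduced]

theorem cartan_mem_finiteTypePairs (b : R.Base) {i j : b.support} (hij : i ≠ j) :
    (cartan b i j, cartan b j i) ∈ finiteTypePairs := by
  have hne : (i : ι) ≠ j := fun h => hij (Subtype.ext h)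
  have hmem := R.pairingIn_pairingIn_mem_set_of_isCrystal_of_isRed' j i
    (fun h => hne (R.root.injective h).symm) (b.root_ne_neg_of_ne j.2 i.2 hne.symm)
  have hle := b.pairingIn_le_zero_of_ne hne i.2 j.2
  change (R.pairingIn ℤ j i, R.pairingIn ℤ i j) ∈ _
  simp only [finiteTypePairs, Set.mem_insert_iff, Set.mem_singleton_iff, Prod.mk.injEq] at hmem ⊢
  omega

theorem IsReducedExpression.isReduced [R.IsRootSystem] {b : R.Base} {l : List b.support}
    {w : R.weylGroup} (hl : IsReducedExpression b l w) {m : b.support → b.support → ℕ}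
    {m_symm : ∀ i j, m i j = m j i} {m_pos : ∀ i j, 0 < m i j}
    {hA : IsDeformedCartan (Subsemiring.nonneg ℤ) b.cartanMatrix m} :
    (weylPositiveSystem b m m_symm m_pos hA).IsReduced l := by
  have hprod : ∀ l', (weylPositiveSystem b m m_symm m_pos hA).prod l' = simpleWord b l' :=
    fun l' => (simpleWord_eq_prod_map b l').symm
  intro l' hl'
  rw [hprod, hprod, hl.1] at hl'
  exact hl.2 l' hl'

end Transfer

end QAff

end

theorem mainTheorem2_general {ι k M N : Type*} [Finite ι] [DecidableEq ι] [Field k] [CharZero k]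
    [AddCommGroup M] [Module k M] [AddCommGroup N] [Module k N]
    (R : RootPairing ι k M N) [R.IsRootSystem] [R.IsCrystallographic] [R.IsReduced]
    (b : R.Base) (d : b.support → ℕ)
    (hd_symm : ∀ i j, (d i : ℤ) * QAff.cartan b i j = (d j : ℤ) * QAff.cartan b j i)
    (hd_norm : ∀ i j, QAff.cartan b j i < -1 → d j = 1)
    (q : ℂˣ) (π : QAff.ellWeights b.support) (hπ : π ∈ QAff.dominant b.support)
    (w : R.weylGroup) (l : List b.support) (hl : QAff.IsReducedExpression b l w) :
    QAff.ellLE (QAff.cartan b) d q (QAff.braidWord (QAff.cartan b) d q l π) π := by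
  have hpair : ∀ i j, i ≠ j → (QAff.cartan b i j, QAff.cartan b j i) ∈ QAff.finiteTypePairs :=
    fun i j => QAff.cartan_mem_finiteTypePairs b
  have hquantum : QAff.IsDeformedCartan QAff.natPolynomials (QAff.quantumCartan (QAff.cartan b) d)
      (QAff.braidLength (QAff.cartan b)) :=
    QAff.isDeformedCartan_quantumCartan hpair hd_symm hd_norm
  have hclassical := hquantum.map (Polynomial.evalRingHom 1) QAff.natPolynomials_le_comap_eval_one
  rw [QAff.quantumCartan_map_eval_one (A := QAff.cartan b) b.cartanMatrix_apply_same hpair]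
    at hclassical
  exact QAff.ellLE_braidWord (QAff.weylPositiveSystem b (QAff.braidLength (QAff.cartan b))
    QAff.braidLength_comm QAff.braidLength_pos hclassical) hquantum hπ hl.isReduced

theorem mainTheorem2 {ι k M N : Type*} [Finite ι] [DecidableEq ι] [Field k] [CharZero k]
    [AddCommGroup M] [Module k M] [AddCommGroup N] [Module k N]
    (R : RootPairing ι k M N) [R.IsRootSystem] [R.IsCrystallographic] [R.IsReduced]
    [R.IsIrreducible] (b : R.Base)
    (d : b.support → ℕ) (hd_pos : ∀ i, 0 < d i)
    (hd_symm : ∀ i j, (d i : ℤ) * QAff.cartan b i j = (d j : ℤ) * QAff.cartan b j i)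
    (hd_norm : ∀ i j, QAff.cartan b j i < -1 → d j = 1)
    (q : ℂˣ) (hq : ∀ m : ℕ, 0 < m → q ^ m ≠ 1)
    (π : QAff.ellWeights b.support) (hπ : π ∈ QAff.dominant b.support)
    (w : R.weylGroup) (l : List b.support) (hl : QAff.IsReducedExpression b l w) :
    QAff.ellLE (QAff.cartan b) d q (QAff.braidWord (QAff.cartan b) d q l π) π :=
  mainTheorem2_general R b d hd_symm hd_norm q π hπ w l hl
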